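/- Let $n\ge 1$ be an integer. Let $A(n)=(a_{kl})_{k,l\ge 1}$ be the infinite $\{0,1\}$-matrix constructed greedily, row by row and from left to right in each row: $a_{kl}=0$ if $\sum_{j<l}a_{kj}\ge n+1$, or $\sum_{i<k}a_{il}\ge n+1$, or there are $1\le i<k$ and $1\le j<l$ with $a_{ij}=a_{il}=a_{kj}=1$; otherwise $a_{kl}=1$. Let $p(n)$ be the smallest $p\ge 1$ for which there is a $c\ge 0$ with $a_{i+p,j+p}=a_{ij}$ for all $i>c$ and $j\ge 1$; let $pp(n)$ be the smallest $c\ge 0$ with $a_{i+p(n),j+p(n)}=a_{ij}$ for all $i>c$ and $j\ge 1$; and let $b(n)=\max\{|j-i| : i,j\ge 1,\ a_{ij}=1,\ i>pp(n)\}$. Then these two minima and this maximum exist, and the following holds for all integers $m\ge 1$ and $v$. Put $\overline p=p(n)\,m$ and $r=\lfloor \overline p/2\rfloor$, and suppose that $r>b(n)$ and $v\ge pp(n)+\overline p$. Then the $\overline p\times\overline p$-matrix $B=(b_{ij})_{1\le i,j\le \overline p}$ with $$b_{ij}=\begin{cases} a_{v+i,\,v+j} & \text{if } i-r\le j\le i+r,\\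 a_{v+i,\,v+j-\overline p} & \text{if } j>i+r,\\ a_{v+i,\,v+j+\overline p} & \text{if } j<i-r\end{cases}$$ is symmetric. -/

import Mathlib

namespace FirstChoice

/-- The entry `a_{kl}` of the first choice matrix `A(n)`, for `k, l ≥ 1`; row `0` and column `0`
are zero padding, so that they contribute neither to the sums nor to the rectangles below.
The entry is `1` unless there are already `n + 1` ones to its left in row `k`, or `n + 1` ones above
it in column `l`, or it would complete a rectangle of ones with a cell `(i, j)`, `i < k`, `j < l`. -/
def entry (n k l : ℕ) : ℕ :=
  if k = 0 ∨ l = 0 then 0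
  else if n + 1 ≤ ∑ j : Fin l, entry n k j ∨ n + 1 ≤ ∑ i : Fin k, entry n i l then 0
  else if ∃ i : Fin k, ∃ j : Fin l, entry n i j = 1 ∧ entry n i l = 1 ∧ entry n k j = 1 then 0
  else 1
termination_by k + l
decreasing_by all_goals omega

/-- `a_{i+p,j+p} = a_{ij}` for all `i > c` and all `j ≥ 1`. -/
def IsPeriodicAfter (n p c : ℕ) : Prop :=
  ∀ i j : ℕ, c < i → 1 ≤ j → entry n (i + p) (j + p) = entry n i j

/-- The numbers `p ≥ 1` that are periods of `A(n)`, with some preperiod. -/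
def periods (n : ℕ) : Set ℕ := {p | 1 ≤ p ∧ ∃ c : ℕ, IsPeriodicAfter n p c}

/-- The period `p(n)`: the least element of `periods n`. -/
noncomputable def period (n : ℕ) : ℕ := sInf (periods n)

/-- The numbers after which `A(n)` is periodic with period `p(n)`. -/
def preperiods (n : ℕ) : Set ℕ := {c | IsPeriodicAfter n (period n) c}

/-- The preperiod `pp(n)`: the least element of `preperiods n`. -/
noncomputable def preperiod (n : ℕ) : ℕ := sInf (preperiods n)

/-- The distances `|j - i|` from the main diagonal of the ones of `A(n)` in rows `i > pp(n)`. -/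
def diagonalDistances (n : ℕ) : Set ℕ :=
  {d | ∃ i j : ℕ, 1 ≤ i ∧ 1 ≤ j ∧ entry n i j = 1 ∧ preperiod n < i ∧
    d = ((j : ℤ) - (i : ℤ)).natAbs}

/-- The breadth `b(n)`: the greatest element of `diagonalDistances n`. -/
noncomputable def breadth (n : ℕ) : ℕ := sSup (diagonalDistances n)

/-- The entry `b_{ij}`, `1 ≤ i, j ≤ q`, of the folded matrix of size `q` with offset `v ≥ q`,
where `r = ⌊q / 2⌋`. -/
def foldedEntry (n q v i j : ℕ) : ℕ :=
  if i ≤ j + q / 2 ∧ j ≤ i + q / 2 then entry n (v + i) (v + j)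
  else if i + q / 2 < j then entry n (v + i) (v + j - q)
  else entry n (v + i) (v + j + q)

/-- The folded `q × q` matrix `B`; the index `i : Fin q` stands for the row or column number
`i + 1`. -/
def folded (n q v : ℕ) : Matrix (Fin q) (Fin q) ℕ :=
  Matrix.of fun i j => foldedEntry n q v (i + 1) (j + 1)

end FirstChoice

namespace FirstChoice

open Finset

variable {n k l : ℕ}

/-! The greedy rule is invariant under transposition, so `A(n)` is symmetric (`entry_symm`).
Counting shows that its ones lie in a band around the diagonal (`le_add_bandBound`), so the rule
acts locally: a diagonal block of twice the band bound determines everything below and to the right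
of it (`entry_add_eq_of_block_eq`). There are finitely many such blocks, so one recurs, which gives
a period; the band bound also makes the distances bounded. Folding shifts the corners by a multiple
of the period, and symmetry of `A(n)` plus periodicity match each shifted entry with its transpose.
-/

theorem entry_eq_one_iff : entry n k l = 1 ↔
    k ≠ 0 ∧ l ≠ 0 ∧ ∑ j ∈ range l, entry n k j < n + 1 ∧ ∑ i ∈ range k, entry n i l < n + 1 ∧
      ∀ i < k, ∀ j < l, entry n i j = 1 → entry n i l = 1 → entry n k j ≠ 1 := by
  rw [entry]
  simp only [Fin.sum_univ_eq_sum_range (fun j => entry n k j),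
    Fin.sum_univ_eq_sum_range (fun i => entry n i l)]
  constructor
  · intro h
    split_ifs at h with h1 h2 h3
    simp only [not_or, not_le] at h1 h2
    exact ⟨h1.1, h1.2, h2.1, h2.2, fun i hi j hj ha hb hc =>
      h3 ⟨⟨i, hi⟩, ⟨j, hj⟩, ha, hb, hc⟩⟩
  · rintro ⟨hk, hl, hr, hc, hq⟩
    rw [if_neg (by tauto), if_neg (by omega), if_neg]
    rintro ⟨i, j, ha, hb, hc⟩
    exact hq i i.2 j j.2 ha hb hc

theorem entry_eq_zero_or_one (n k l : ℕ) : entry n k l = 0 ∨ entry n k l = 1 := by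
  rw [entry]
  split_ifs <;> simp

theorem entry_congr {k' l' : ℕ} (h : entry n k l = 1 ↔ entry n k' l' = 1) :
    entry n k l = entry n k' l' := by
  have h₁ := entry_eq_zero_or_one n k l
  have h₂ := entry_eq_zero_or_one n k' l'
  omega

/-- The rule at `(k, l)` consults only cells with smaller index sum, and transposition swaps its row
and column conditions and preserves the rectangle condition. -/
theorem entry_symm (n k l : ℕ) : entry n k l = entry n l k := by
  induction h : k + l using Nat.strong_induction_on generalizing k l with
  | _ s ih =>
    subst h
    apply entry_congr
    rw [entry_eq_one_iff, entry_eq_one_iff,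
      sum_congr rfl fun j hj => ih (k + j) (by have := mem_range.1 hj; omega) k j rfl,
      sum_congr rfl fun i hi => ih (i + l) (by have := mem_range.1 hi; omega) i l rfl]
    have key : (∀ i < k, ∀ j < l, entry n i j = 1 → entry n i l = 1 → entry n k j ≠ 1) ↔
        ∀ i < l, ∀ j < k, entry n i j = 1 → entry n i k = 1 → entry n l j ≠ 1 := by
      constructor
      · intro h i hi j hj ha hb hc
        refine h j hj i hi ?_ ?_ ?_
        · rwa [ih (j + i) (by omega) j i rfl]
        · rwa [ih (j + l) (by omega) j l rfl]
        · rwa [ih (k + i) (by omega) k i rfl]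
      · intro h i hi j hj ha hb hc
        refine h j hj i hi ?_ ?_ ?_
        · rwa [← ih (i + j) (by omega) i j rfl]
        · rwa [← ih (k + j) (by omega) k j rfl]
        · rwa [← ih (i + l) (by omega) i l rfl]
    rw [key]
    tauto

theorem sum_row_le (n k l : ℕ) : ∑ j ∈ range l, entry n k j ≤ n + 1 := by
  induction l with
  | zero => simp
  | succ l ih =>
    rw [sum_range_succ]
    rcases entry_eq_zero_or_one n k l with h | h
    · omega
    · have := (entry_eq_one_iff.1 h).2.2.1
      omega

theorem card_filter_entry (s : Finset ℕ) (f : ℕ → ℕ × ℕ) :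
    #{j ∈ s | entry n (f j).1 (f j).2 = 1} = ∑ j ∈ s, entry n (f j).1 (f j).2 := by
  rw [card_filter]
  refine sum_congr rfl fun j _ => ?_
  rcases entry_eq_zero_or_one n (f j).1 (f j).2 with h | h <;> simp [h]

theorem card_row_le (n k l : ℕ) : #{j ∈ range l | entry n k j = 1} ≤ n + 1 :=
  (card_filter_entry (range l) fun j => (k, j)).trans_le (sum_row_le n k l)

theorem card_column_le (n k l : ℕ) : #{i ∈ range k | entry n i l = 1} ≤ n + 1 := by
  simp only [entry_symm n _ l]
  exact card_row_le n l k

/-- Double counting: the rows above `k` hold at most `k * (n + 1)` ones, and each full column uses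
`n + 1` of them. -/
theorem card_full_columns_le (n k l : ℕ) :
    #{j ∈ range l | n + 1 ≤ ∑ i ∈ range k, entry n i j} ≤ k := by
  refine Nat.le_of_mul_le_mul_right ?_ n.succ_pos
  calc _ ≤ ∑ j ∈ range l with n + 1 ≤ ∑ i ∈ range k, entry n i j, ∑ i ∈ range k, entry n i j := by
        rw [← smul_eq_mul]
        exact card_nsmul_le_sum _ _ _ fun j hj => (mem_filter.1 hj).2
    _ ≤ ∑ j ∈ range l, ∑ i ∈ range k, entry n i j := sum_le_sum_of_subset (filter_subset _ _)
    _ = ∑ i ∈ range k, ∑ j ∈ range l, entry n i j := sum_comm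
    _ ≤ k * (n + 1) := by
        simpa using sum_le_card_nsmul (range k) _ (n + 1) fun i _ => sum_row_le n i l

/-- A bound for the distances of the ones of `A(n)` from the main diagonal. -/
def bandBound (n : ℕ) : ℕ := 1 + (n + 1) + (n + 1) * ((n + 1) * (n + 1))

/-- Row `k` is not yet full before column `l`, so each zero there, apart from the padding, is due to
a full column or a rectangle. Full columns number at most `k`; the rest is bounded in terms of `n`
alone. -/
theorem le_add_bandBound (h : entry n k l = 1) : l ≤ k + bandBound n := by
  obtain ⟨hk, -, hr, -, -⟩ := entry_eq_one_iff.1 h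
  let ones := {j ∈ range l | entry n k j = 1}
  let full := {j ∈ range l | n + 1 ≤ ∑ i ∈ range k, entry n i j}
  -- A column blocked by a rectangle is reached from row `k` by three steps along ones: to a column,
  -- up to a row, across to the blocked column. Each step has at most `n + 1` choices.
  let rect := ones.biUnion fun j => {i ∈ range k | entry n i j = 1}.biUnion fun i =>
    {j ∈ range l | entry n i j = 1}
  have hsub : range l ⊆ {0} ∪ ones ∪ rect ∪ full := by
    intro j hj
    by_contra hn
    simp only [mem_union, not_or, mem_singleton] at hn
    obtain ⟨⟨⟨h0, h1⟩, h2⟩, h3⟩ := hn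
    have hjl := mem_range.1 hj
    refine h1 (mem_filter.2 ⟨hj, entry_eq_one_iff.2 ⟨hk, h0, ?_, ?_, ?_⟩⟩)
    · exact (sum_le_sum_of_subset (range_mono hjl.le)).trans_lt hr
    · by_contra hc
      exact h3 (mem_filter.2 ⟨hj, not_lt.1 hc⟩)
    · intro i hi j' hj' ha hb hc
      refine h2 (mem_biUnion.2 ⟨j', mem_filter.2 ⟨mem_range.2 (by omega), hc⟩,
        mem_biUnion.2 ⟨i, mem_filter.2 ⟨mem_range.2 hi, ha⟩, mem_filter.2 ⟨hj, hb⟩⟩⟩)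
  have hrect : #rect ≤ (n + 1) * ((n + 1) * (n + 1)) := by
    refine (card_biUnion_le_card_mul _ _ ((n + 1) * (n + 1)) fun j _ => ?_).trans
      (Nat.mul_le_mul_right _ (card_row_le n k l))
    exact (card_biUnion_le_card_mul _ _ (n + 1) fun i _ => card_row_le n i l).trans
      (Nat.mul_le_mul_right _ (card_column_le n k j))
  have hcard := card_le_card hsub
  have h₁ := card_union_le ({0} ∪ ones ∪ rect) full
  have h₂ := card_union_le ({0} ∪ ones) rect
  have h₃ := card_union_le {0} ones
  have hones : #ones ≤ n + 1 := card_row_le n k l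
  have hfull : #full ≤ k := card_full_columns_le n k l
  rw [card_range] at hcard
  rw [card_singleton] at h₃
  unfold bandBound
  omega

theorem entry_eq_zero_of_lt (h : k + bandBound n < l) : entry n k l = 0 :=
  (entry_eq_zero_or_one n k l).resolve_right fun h1 => by
    have := le_add_bandBound h1
    omega

theorem entry_eq_zero_of_gt (h : l + bandBound n < k) : entry n k l = 0 := by
  rw [entry_symm, entry_eq_zero_of_lt h]

/-- Far enough from the origin, the greedy rule does not depend on the offset `k`. -/
theorem entry_add_eq_one_iff {x y : ℕ} (hk : k ≠ 0) (hx : bandBound n ≤ x)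
    (hy : bandBound n ≤ y) : entry n (k + x) (k + y) = 1 ↔
      ∑ j ∈ range y, entry n (k + x) (k + j) < n + 1 ∧
      ∑ i ∈ range x, entry n (k + i) (k + y) < n + 1 ∧
      ∀ i < x, ∀ j < y, entry n (k + i) (k + j) = 1 → entry n (k + i) (k + y) = 1 →
        entry n (k + x) (k + j) ≠ 1 := by
  have hrow : ∑ j ∈ range k, entry n (k + x) j = 0 :=
    sum_eq_zero fun j hj => entry_eq_zero_of_gt (by have := mem_range.1 hj; omega)
  have hcol : ∑ i ∈ range k, entry n i (k + y) = 0 :=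
    sum_eq_zero fun i hi => entry_eq_zero_of_lt (by have := mem_range.1 hi; omega)
  rw [entry_eq_one_iff, sum_range_add, sum_range_add, hrow, hcol, zero_add, zero_add]
  constructor
  · rintro ⟨-, -, hr, hc, hq⟩
    exact ⟨hr, hc, fun i hi j hj => hq _ (by omega) _ (by omega)⟩
  · rintro ⟨hr, hc, hq⟩
    refine ⟨by omega, by omega, hr, hc, fun i hi j hj ha hb hd => ?_⟩
    -- By the band bound, any rectangle ending at this cell already lies inside the quadrant
    -- starting at `(k, k)`.
    have hi' : k ≤ i := by
      by_contra hlt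
      have := le_add_bandBound hb
      omega
    have hj' : k ≤ j := by
      by_contra hlt
      rw [entry_symm] at hd
      have := le_add_bandBound hd
      omega
    obtain ⟨i, rfl⟩ := Nat.exists_eq_add_of_le hi'
    obtain ⟨j, rfl⟩ := Nat.exists_eq_add_of_le hj'
    exact hq i (by omega) j (by omega) ha hb hd

/-- Two equal diagonal blocks of size `2 * bandBound n` have equal continuations. -/
theorem entry_add_eq_of_block_eq {k' : ℕ} (hk : k ≠ 0) (hk' : k' ≠ 0)
    (h : ∀ x < 2 * bandBound n, ∀ y < 2 * bandBound n,
      entry n (k + x) (k + y) = entry n (k' + x) (k' + y)) (x y : ℕ) :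
    entry n (k + x) (k + y) = entry n (k' + x) (k' + y) := by
  induction hs : x + y using Nat.strong_induction_on generalizing x y with
  | _ s ih =>
    subst hs
    by_cases hxy : x < 2 * bandBound n ∧ y < 2 * bandBound n
    · exact h x hxy.1 y hxy.2
    rcases lt_or_ge (x + bandBound n) y with h1 | h1
    · rw [entry_eq_zero_of_lt (by omega), entry_eq_zero_of_lt (by omega)]
    rcases lt_or_ge (y + bandBound n) x with h2 | h2
    · rw [entry_eq_zero_of_gt (by omega), entry_eq_zero_of_gt (by omega)]
    apply entry_congr
    rw [entry_add_eq_one_iff hk (by omega) (by omega),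
      entry_add_eq_one_iff hk' (by omega) (by omega),
      sum_congr rfl fun j hj => ih (x + j) (by have := mem_range.1 hj; omega) x j rfl,
      sum_congr rfl fun i hi => ih (i + y) (by have := mem_range.1 hi; omega) i y rfl]
    refine and_congr_right fun _ => and_congr_right fun _ => forall₂_congr fun i hi =>
      forall₂_congr fun j hj => ?_
    rw [ih (i + j) (by omega) i j rfl, ih (i + y) (by omega) i y rfl, ih (x + j) (by omega) x j rfl]

theorem periods_nonempty (n : ℕ) : (periods n).Nonempty := by
  let block : ℕ → Fin (2 * bandBound n) → Fin (2 * bandBound n) → Prop :=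
    fun k x y => entry n (k + 1 + x) (k + 1 + y) = 1
  obtain ⟨k, k', hne, heq⟩ := Finite.exists_ne_map_eq_of_infinite block
  wlog hlt : k < k' generalizing k k'
  · exact this k' k hne.symm heq.symm (by omega)
  have key := entry_add_eq_of_block_eq (n := n) (k.succ_ne_zero) (k'.succ_ne_zero)
    fun x hx y hy => entry_congr (congrFun₂ heq ⟨x, hx⟩ ⟨y, hy⟩).to_iff
  -- The extra `bandBound n` rows put the columns left of the block outside the band, before and
  -- after the shift.
  refine ⟨k' - k, by omega, k + 1 + bandBound n, fun i j hi _ => ?_⟩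
  rcases lt_or_ge j (k + 1) with hj | hj
  · rw [entry_eq_zero_of_gt (by omega), entry_eq_zero_of_gt (by omega)]
  · convert (key (i - (k + 1)) (j - (k + 1))).symm using 2 <;> omega

theorem period_mem (n : ℕ) : period n ∈ periods n := Nat.sInf_mem (periods_nonempty n)

theorem preperiod_mem (n : ℕ) : preperiod n ∈ preperiods n := Nat.sInf_mem (period_mem n).2

/-- In an all-zero row, nothing would forbid a one just past the band, where the column above is
still empty. -/
theorem exists_entry_eq_one (hk : k ≠ 0) : ∃ l, entry n k l = 1 := by
  by_contra! h
  refine h (k + bandBound n + 1) (entry_eq_one_iff.2 ⟨hk, by omega, ?_, ?_, ?_⟩)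
  · rw [sum_eq_zero fun j _ => (entry_eq_zero_or_one n k j).resolve_right (h j)]
    omega
  · rw [sum_eq_zero fun i hi => entry_eq_zero_of_lt (by have := mem_range.1 hi; omega)]
    omega
  · exact fun _ _ j _ _ _ => h j

theorem diagonalDistances_nonempty (n : ℕ) : (diagonalDistances n).Nonempty := by
  obtain ⟨l, hl⟩ := exists_entry_eq_one (n := n) (preperiod n).succ_ne_zero
  exact ⟨_, _, l, Nat.succ_pos _, Nat.pos_of_ne_zero (entry_eq_one_iff.1 hl).2.1, hl,
    Nat.lt_succ_self _, rfl⟩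

theorem diagonalDistances_bddAbove (n : ℕ) : BddAbove (diagonalDistances n) := by
  refine ⟨bandBound n, ?_⟩
  rintro _ ⟨i, j, -, -, h, -, rfl⟩
  have h₁ := le_add_bandBound h
  rw [entry_symm] at h
  have h₂ := le_add_bandBound h
  omega

theorem IsPeriodicAfter.mul {p c : ℕ} (h : IsPeriodicAfter n p c) (m : ℕ) :
    IsPeriodicAfter n (p * m) c := by
  induction m with
  | zero => intro i j _ _; simp
  | succ m ih =>
    intro i j hi hj
    rw [Nat.mul_succ, ← add_assoc, ← add_assoc, h _ _ (by omega) (by omega), ih i j hi hj]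

theorem foldedEntry_symm_of_lt {q v i j : ℕ} {c : ℕ} (h : IsPeriodicAfter n q c) (hv : c + q ≤ v)
    (hi : 1 ≤ i) (hj : 1 ≤ j) (hij : i + q / 2 < j) :
    foldedEntry n q v i j = foldedEntry n q v j i := by
  unfold foldedEntry
  -- The upper corner entry at `(v + i, v + j - q)` moves by one period to `(v + i + q, v + j)`, the
  -- transpose of the lower corner entry. The bound `c + q ≤ v` keeps `v + j - q` positive and
  -- untruncated.
  rw [if_neg (by omega), if_pos hij, if_neg (by omega), if_neg (by omega),
    ← h _ _ (by omega) (by omega), entry_symm]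
  congr 1
  omega

theorem foldedEntry_symm {q v i j : ℕ} {c : ℕ} (h : IsPeriodicAfter n q c) (hv : c + q ≤ v)
    (hi : 1 ≤ i) (hj : 1 ≤ j) : foldedEntry n q v i j = foldedEntry n q v j i := by
  rcases lt_or_ge (i + q / 2) j with hij | hij
  · exact foldedEntry_symm_of_lt h hv hi hj hij
  rcases lt_or_ge (j + q / 2) i with hji | hji
  · exact (foldedEntry_symm_of_lt h hv hj hi hji).symm
  unfold foldedEntry
  rw [if_pos ⟨hji, hij⟩, if_pos ⟨hij, hji⟩, entry_symm]

end FirstChoice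

theorem theorem4p2 (n : ℕ) (hn : 1 ≤ n) :
    -- the numbers `p(n)`, `pp(n)`, `b(n)` exist as the minima and the maximum defining them
    (IsLeast (FirstChoice.periods n) (FirstChoice.period n) ∧
      IsLeast (FirstChoice.preperiods n) (FirstChoice.preperiod n) ∧
      IsGreatest (FirstChoice.diagonalDistances n) (FirstChoice.breadth n)) ∧
    -- every folded matrix is symmetric
    ∀ m v : ℕ, 1 ≤ m →
      FirstChoice.breadth n < FirstChoice.period n * m / 2 →
      FirstChoice.preperiod n + FirstChoice.period n * m ≤ v →
      (FirstChoice.folded n (FirstChoice.period n * m) v).IsSymm := by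
  refine ⟨⟨⟨FirstChoice.period_mem n, fun _ h => Nat.sInf_le h⟩,
    ⟨FirstChoice.preperiod_mem n, fun _ h => Nat.sInf_le h⟩,
    Nat.sSup_mem (FirstChoice.diagonalDistances_nonempty n)
      (FirstChoice.diagonalDistances_bddAbove n),
    fun _ h => le_csSup (FirstChoice.diagonalDistances_bddAbove n) h⟩, fun m v _ _ hv => ?_⟩
  have hper : FirstChoice.IsPeriodicAfter n (FirstChoice.period n * m) (FirstChoice.preperiod n) :=
    FirstChoice.IsPeriodicAfter.mul (FirstChoice.preperiod_mem n) m
  ext i j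
  exact FirstChoice.foldedEntry_symm hper hv (Nat.succ_pos _) (Nat.succ_pos _)
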